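/- Let $G$ be a group acting on a set $X$ and let $\mathcal I$ be a $G$-invariant Boolean ideal on $X$, that is, a proper ideal of the Boolean algebra of all subsets of $X$ such that $gA\in\mathcal I$ for all $g\in G$, $A\in\mathcal I$. For a set $Y$ let $P(Y)$ be the set of all finitely additive probability measures defined on all subsets of $Y$, and put $P_{\mathcal I}(X)=\{\nu\in P(X):\nu(A)=0\text{ for all }A\in\mathcal I\}$. For a subgroup $H\le G$, $\lambda\in P(H)$ and $\nu\in P(X)$ the convolution $\lambda*\nu\in P(X)$ is defined by $(\lambda*\nu)(A)=\int_H\nu(h^{-1}A)\,d\lambda(h)$; $\delta_x$ is the Dirac measure at $x$. For $\mu\in P(X)$ put $$P_{\mathcal I}(H;\mu)=\{\lambda\in P(H):\lambda*\delta_x*\mu\in P_{\mathcal I}(X)\text{ for all }x\in H\}.$$ Let $\mathcal H$ be the family of all countable subgroups of $G$. A family $\mathcal C\subseteq\mathcal H$ is closed if $\bigcup_{k}H_k\in\mathcal C$ for every increasing sequence $(H_k)_{k\in\omega}$ of members of $\mathcal C$; it is dominating if every $H\in\mathcal H$ is contained in some member of $\mathcal C$. A family $\mathcal F\subseteq\mathcal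 H$ is stationary if $\mathcal F\cap\mathcal C\ne\emptyset$ for every closed dominating $\mathcal C\subseteq\mathcal H$. For $A\subseteq X$ let $\Delta_{\mathcal I}(A)=\{g\in G:gA\cap A\notin\mathcal I\}$. For $B\subseteq G$ and a Boolean ideal $\mathcal J$ on $G$ let $\mathrm{cov}(B)=\min\{|F|:F\subseteq G,\ FB=G\}$ and $\mathrm{cov}_{\mathcal J}(B)=\min\{|F|:F\subseteq G,\ G\setminus FB\in\mathcal J\}$, where both are $\infty$ (larger than every cardinal) for $B=\emptyset$. Theorem. Let $\mu\in P(X)$ be such that $\{H\in\mathcal H:P_{\mathcal I}(H;\mu)\ne\emptyset\}$ is stationary. Then for every partition $X=A_1\cup\dots\cup A_n$ into pairwise disjoint sets, either 1. $\mathrm{cov}(\Delta_{\mathcal I}(A_i))\le n$ for all $i\in\{1,\dots,n\}$, or else 2. there are $i\in\{1,\dots,n\}$ and a $G$-invariant Boolean ideal $\mathcal J$ on $G$ (a proper ideal of subsets of $G$ invariant under left translations) such that $\{x\in G:\mu(xA_i)>\frac1n\}\notin\mathcal J$ and $\mathrm{cov}_{\mathcal J}(\Delta_{\mathcal I}(A_i))<n$.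 -/

import Mathlib

open scoped Pointwise NNReal

namespace IdealGSpace

/-- Finitely additive probability measures defined on all subsets of `X`. -/
structure FinAddProb (X : Type*) extends
    MeasureTheory.AddContent ℝ≥0 (Set.univ : Set (Set X)) where
  univ' : toFun Set.univ = 1

namespace FinAddProb

variable {X : Type*}

instance : CoeFun (FinAddProb X) (fun _ => Set X → ℝ≥0) := ⟨fun m => m.toFun⟩

lemma isSetRing_univ : MeasureTheory.IsSetRing (Set.univ : Set (Set X)) :=
  ⟨trivial, fun _ _ _ _ => trivial, fun _ _ _ _ => trivial⟩

/-- Build a finitely additive probability measure from additivity on two disjoint sets. -/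
noncomputable def ofUnion (f : Set X → ℝ≥0) (h0 : f ∅ = 0) (h1 : f Set.univ = 1)
    (hU : ∀ s t, Disjoint s t → f (s ∪ t) = f s + f t) : FinAddProb X where
  toAddContent := isSetRing_univ.addContent_of_union f h0 (fun _ _ h => hU _ _ h)
  univ' := h1

lemma empty (m : FinAddProb X) : m ∅ = 0 := m.empty'

lemma union (m : FinAddProb X) {s t : Set X} (h : Disjoint s t) : m (s ∪ t) = m s + m t :=
  MeasureTheory.addContent_union (m := m.toAddContent) isSetRing_univ trivial trivial h

lemma sum_fiber (m : FinAddProb X) {ι : Type} [Fintype ι] (p : X → ι) (s : Set X) :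
    m s = ∑ i, m (s ∩ p ⁻¹' {i}) := by
  have h := MeasureTheory.addContent_biUnion (m := m.toAddContent) (a := Finset.univ)
    (f := fun i => s ∩ p ⁻¹' {i}) (fun _ _ => trivial)
    (by
      intro i _ j _ hij
      refine Set.disjoint_left.2 ?_
      rintro x ⟨_, hx⟩ ⟨_, hy⟩
      exact hij (by simp_all)) trivial
  have e : (⋃ i ∈ (Finset.univ : Finset ι), s ∩ p ⁻¹' {i}) = s := by
    ext x; simp
  rw [e] at h
  exact h

/-- `∑ i, c i * m (p ⁻¹' {i})`, the integral of the finitely valued function `c ∘ p`. -/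
noncomputable def simpleSum (m : FinAddProb X) {ι : Type} [Fintype ι] (p : X → ι) (c : ι → ℝ) :
    ℝ :=
  ∑ i, c i * (m (p ⁻¹' {i}) : ℝ)

/-- The integrals of the finitely valued functions lying below `f`. -/
def lowerSums (m : FinAddProb X) (f : X → ℝ) : Set ℝ :=
  {r | ∃ (ι : Type) (_ : Fintype ι) (p : X → ι) (c : ι → ℝ),
    (∀ x, c (p x) ≤ f x) ∧ r = m.simpleSum p c}

/-- The integral of a bounded function `f : X → ℝ` against a finitely additive probability
measure: the supremum of the integrals of finitely valued functions below `f`. -/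
noncomputable def integral (m : FinAddProb X) (f : X → ℝ) : ℝ := sSup (m.lowerSums f)

section IntegralFacts

variable (m : FinAddProb X)

lemma simpleSum_fst {ι κ : Type} [Fintype ι] [Fintype κ] (p : X → ι) (q : X → κ) (c : ι → ℝ) :
    m.simpleSum (fun x => (p x, q x)) (fun z => c z.1) = m.simpleSum p c := by
  unfold simpleSum
  rw [Fintype.sum_prod_type]
  refine Finset.sum_congr rfl fun i _ => ?_
  rw [m.sum_fiber q (p ⁻¹' {i}), NNReal.coe_sum, Finset.mul_sum]
  refine Finset.sum_congr rfl fun j _ => ?_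
  congr 3
  ext x; simp

lemma simpleSum_snd {ι κ : Type} [Fintype ι] [Fintype κ] (p : X → ι) (q : X → κ) (c : κ → ℝ) :
    m.simpleSum (fun x => (p x, q x)) (fun z => c z.2) = m.simpleSum q c := by
  unfold simpleSum
  rw [Fintype.sum_prod_type_right]
  refine Finset.sum_congr rfl fun j _ => ?_
  rw [m.sum_fiber p (q ⁻¹' {j}), NNReal.coe_sum, Finset.mul_sum]
  refine Finset.sum_congr rfl fun i _ => ?_
  congr 3
  ext x; simp [and_comm]

lemma simpleSum_mono' {ι : Type} [Fintype ι] (p : X → ι) (c d : ι → ℝ)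
    (h : ∀ x, c (p x) ≤ d (p x)) : m.simpleSum p c ≤ m.simpleSum p d := by
  refine Finset.sum_le_sum fun i _ => ?_
  by_cases hi : ∃ x, p x = i
  · obtain ⟨x, rfl⟩ := hi
    exact mul_le_mul_of_nonneg_right (h x) (NNReal.coe_nonneg _)
  · have : p ⁻¹' {i} = ∅ := by
      ext x; simpa using fun hx => hi ⟨x, hx⟩
    simp [this, m.empty]

lemma simpleSum_mono {ι κ : Type} [Fintype ι] [Fintype κ] (p : X → ι) (q : X → κ) (c : ι → ℝ)
    (d : κ → ℝ) (h : ∀ x, c (p x) ≤ d (q x)) : m.simpleSum p c ≤ m.simpleSum q d := by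
  rw [← m.simpleSum_fst p q c, ← m.simpleSum_snd p q d]
  exact m.simpleSum_mono' _ _ _ h

lemma simpleSum_add {ι κ : Type} [Fintype ι] [Fintype κ] (p : X → ι) (q : X → κ) (c : ι → ℝ)
    (d : κ → ℝ) : m.simpleSum (fun x => (p x, q x)) (fun z => c z.1 + d z.2) =
      m.simpleSum p c + m.simpleSum q d := by
  rw [← m.simpleSum_fst p q c, ← m.simpleSum_snd p q d]
  simp only [simpleSum, add_mul, Finset.sum_add_distrib]

lemma simpleSum_const (b : ℝ) : m.simpleSum (fun _ : X => ()) (fun _ => b) = b := by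
  have h : m (Set.univ : Set X) = 1 := m.univ'
  simp [simpleSum, h]

lemma lowerSums_le {f : X → ℝ} {b r : ℝ} (hb : ∀ x, f x ≤ b) (hr : r ∈ m.lowerSums f) : r ≤ b := by
  obtain ⟨ι, _, p, c, hc, rfl⟩ := hr
  rw [← m.simpleSum_const b]
  exact m.simpleSum_mono _ _ _ _ fun x => (hc x).trans (hb x)

lemma mem_lowerSums_of_le {f : X → ℝ} {a : ℝ} (ha : ∀ x, a ≤ f x) : a ∈ m.lowerSums f :=
  ⟨Unit, inferInstance, fun _ => (), fun _ => a, ha, (m.simpleSum_const a).symm⟩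

lemma bddAbove_lowerSums {f : X → ℝ} {b : ℝ} (hb : ∀ x, f x ≤ b) : BddAbove (m.lowerSums f) :=
  ⟨b, fun _ hr => m.lowerSums_le hb hr⟩

lemma integral_const (b : ℝ) : m.integral (fun _ => b) = b :=
  le_antisymm
    (csSup_le ⟨b, m.mem_lowerSums_of_le fun _ => le_rfl⟩
      fun _ hr => m.lowerSums_le (fun _ => le_rfl) hr)
    (le_csSup (m.bddAbove_lowerSums fun _ => le_rfl) (m.mem_lowerSums_of_le fun _ => le_rfl))

lemma integral_nonneg {f : X → ℝ} {b : ℝ} (h0 : ∀ x, 0 ≤ f x) (hb : ∀ x, f x ≤ b) :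
    0 ≤ m.integral f :=
  le_csSup (m.bddAbove_lowerSums hb) (m.mem_lowerSums_of_le h0)

/-- A function with values in `[0, b]` is uniformly approximated by finitely valued ones. -/
lemma exists_approx {f : X → ℝ} {b : ℝ} (h0 : ∀ x, 0 ≤ f x) (hb : ∀ x, f x ≤ b) {ε : ℝ}
    (hε : 0 < ε) : ∃ (ι : Type) (_ : Fintype ι) (p : X → ι) (c : ι → ℝ),
      (∀ x, c (p x) ≤ f x) ∧ ∀ x, f x ≤ c (p x) + ε := by
  refine ⟨Fin (⌊b / ε⌋₊ + 1), inferInstance, fun x => ⟨⌊f x / ε⌋₊, ?_⟩, fun i => (i : ℕ) * ε,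
    fun x => ?_, fun x => ?_⟩
  · exact Nat.lt_succ_of_le (Nat.floor_le_floor (div_le_div_of_nonneg_right (hb x) hε.le))
  · have := Nat.floor_le (div_nonneg (h0 x) hε.le)
    exact (le_div_iff₀ hε).1 this
  · have := (Nat.lt_floor_add_one (f x / ε)).le
    have := (div_le_iff₀ hε).1 this
    simpa [add_mul] using this

lemma integral_add {f g : X → ℝ} {b b' : ℝ} (hf0 : ∀ x, 0 ≤ f x) (hfb : ∀ x, f x ≤ b)
    (hg0 : ∀ x, 0 ≤ g x) (hgb : ∀ x, g x ≤ b') :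
    m.integral (fun x => f x + g x) = m.integral f + m.integral g := by
  have hbd : BddAbove (m.lowerSums fun x => f x + g x) :=
    m.bddAbove_lowerSums (b := b + b') fun x => add_le_add (hfb x) (hgb x)
  apply le_antisymm
  · refine csSup_le ⟨0, m.mem_lowerSums_of_le fun x => add_nonneg (hf0 x) (hg0 x)⟩ ?_
    rintro _ ⟨ι, _, p, c, hc, rfl⟩
    refine le_of_forall_pos_le_add fun ε hε => ?_
    obtain ⟨κ, _, q, d, hd, hd'⟩ := exists_approx hf0 hfb (half_pos hε)
    obtain ⟨τ, _, s, e, he, he'⟩ := exists_approx hg0 hgb (half_pos hε)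
    have h1 : m.simpleSum q d ≤ m.integral f :=
      le_csSup (m.bddAbove_lowerSums hfb) ⟨κ, _, q, d, hd, rfl⟩
    have h2 : m.simpleSum s e ≤ m.integral g :=
      le_csSup (m.bddAbove_lowerSums hgb) ⟨τ, _, s, e, he, rfl⟩
    have h3 := m.simpleSum_add (fun x => (q x, s x)) (fun _ => ()) (fun z => d z.1 + e z.2)
      (fun _ => ε)
    rw [m.simpleSum_add, m.simpleSum_const] at h3
    have h4 := m.simpleSum_mono p (fun x => ((q x, s x), ())) c
      (fun z => d z.1.1 + e z.1.2 + ε) fun x => by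
        have := hc x; have := hd' x; have := he' x; simp only; linarith
    linarith
  · rw [← le_sub_iff_add_le]
    refine csSup_le ⟨0, m.mem_lowerSums_of_le hf0⟩ ?_
    rintro _ ⟨ι, _, p, c, hc, rfl⟩
    rw [le_sub_comm]
    refine csSup_le ⟨0, m.mem_lowerSums_of_le hg0⟩ ?_
    rintro _ ⟨κ, _, q, d, hd, rfl⟩
    rw [le_sub_iff_add_le, add_comm, ← m.simpleSum_add]
    exact le_csSup hbd ⟨ι × κ, inferInstance, _, _, fun x => add_le_add (hc x) (hd x), rfl⟩

end IntegralFacts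

lemma le_one (m : FinAddProb X) (s : Set X) : m s ≤ 1 := by
  have h : m (Set.univ : Set X) = 1 := m.univ'
  rw [← h, ← Set.union_compl_self s, m.union disjoint_compl_right]
  exact le_self_add

/-- The Dirac measure at `a`. -/
noncomputable def dirac (a : X) : FinAddProb X := by
  classical
  exact ofUnion (fun s => if a ∈ s then 1 else 0) (by simp) (by simp) (by
    intro s t h
    have hd : a ∈ s → a ∉ t := fun hs => Set.disjoint_left.1 h hs
    by_cases h1 : a ∈ s <;> by_cases h2 : a ∈ t <;> simp_all)

/-- The convolution `l * m` of a measure `l` on the group `G` and a measure `m` on the `G`-space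
`X`: `(l * m) A = ∫ m (g⁻¹ A) dl(g)`. -/
noncomputable def conv {G : Type*} [Group G] [MulAction G X] (l : FinAddProb G)
    (m : FinAddProb X) : FinAddProb X :=
  ofUnion
    (fun A => ⟨l.integral (fun g => (m (g⁻¹ • A) : ℝ)),
      l.integral_nonneg (b := 1) (fun _ => NNReal.coe_nonneg _)
        (fun _ => by exact_mod_cast m.le_one _)⟩)
    (by
      apply NNReal.eq
      simp only [Set.smul_set_empty, m.empty]
      exact l.integral_const 0)
    (by
      have h : m (Set.univ : Set X) = 1 := m.univ'
      apply NNReal.eq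
      simp only [Set.smul_set_univ, h]
      exact l.integral_const 1)
    (by
      intro s t hst
      apply NNReal.eq
      have : ∀ g : G, m (g⁻¹ • (s ∪ t)) = m (g⁻¹ • s) + m (g⁻¹ • t) := fun g => by
        rw [Set.smul_set_union]
        exact m.union ((Set.disjoint_image_iff (MulAction.injective _)).2 hst)
      simp only [this, NNReal.coe_add]
      exact l.integral_add (b := 1) (b' := 1)
        (fun _ => NNReal.coe_nonneg _) (fun _ => by exact_mod_cast m.le_one _)
        (fun _ => NNReal.coe_nonneg _) (fun _ => by exact_mod_cast m.le_one _))

end FinAddProb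

/-- `G`-invariance of an ideal of subsets of a `G`-space. -/
def IsGInvariant (G : Type*) [Group G] {X : Type*} [MulAction G X]
    (I : Order.Ideal (Set X)) : Prop :=
  ∀ g : G, ∀ A ∈ I, g • A ∈ I

/-- The `I`-difference set `{g ∈ G : gA ∩ A ∉ I}`. -/
def diffSet (G : Type*) [Group G] {X : Type*} [MulAction G X]
    (I : Order.Ideal (Set X)) (A : Set X) : Set G :=
  {g | g • A ∩ A ∉ I}

/-- The covering number `min {|F| : F ⊆ G, G = F A}`, a cardinal or `∞ = ⊤` (for `A = ∅`). -/
noncomputable def cov {G : Type*} [Group G] (A : Set G) : WithTop Cardinal :=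
  ⨅ F ∈ {F : Set G | F * A = Set.univ}, ((Cardinal.mk F : Cardinal) : WithTop Cardinal)

/-- The `J`-covering number `min {|F| : F ⊆ G, F A =_J G}`; for a proper ideal `J` it is
`∞ = ⊤` at `A = ∅`. -/
noncomputable def covIdeal {G : Type*} [Group G] (J : Order.Ideal (Set G)) (A : Set G) :
    WithTop Cardinal :=
  ⨅ F ∈ {F : Set G | symmDiff (F * A) Set.univ ∈ J},
    ((Cardinal.mk F : Cardinal) : WithTop Cardinal)

/-- `P_I(X)`: the finitely additive probability measures on `X` vanishing on `I`. -/
def nullMeasures {X : Type*} (I : Order.Ideal (Set X)) : Set (FinAddProb X) :=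
  {m | ∀ A ∈ I, m A = 0}

/-- `P_I(H; μ) = {l ∈ P(H) : l * δ_x * μ ∈ P_I(X) for all x ∈ H}`. -/
def convNullMeasures {G : Type*} [Group G] {X : Type*} [MulAction G X]
    (I : Order.Ideal (Set X)) (H : Subgroup G) (μ : FinAddProb X) : Set (FinAddProb H) :=
  {l | ∀ x : H, l.conv ((FinAddProb.dirac x).conv μ) ∈ nullMeasures I}

/-- The family of all countable subgroups of `G`. -/
def countableSubgroups (G : Type*) [Group G] : Set (Subgroup G) :=
  {H | Countable H}

/-- Closed families of subgroups: closed under unions of increasing sequences. -/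
def IsClosedFamily {G : Type*} [Group G] (F : Set (Subgroup G)) : Prop :=
  ∀ s : ℕ → Subgroup G, Monotone s → (∀ k, s k ∈ F) →
    ∀ K : Subgroup G, (K : Set G) = ⋃ k, (s k : Set G) → K ∈ F

/-- Dominating families: every countable subgroup lies in a member of the family. -/
def IsDominatingFamily {G : Type*} [Group G] (F : Set (Subgroup G)) : Prop :=
  ∀ H ∈ countableSubgroups G, ∃ K ∈ F, H ≤ K

/-- Stationary families: those meeting every closed dominating family of countable subgroups. -/
def IsStationaryFamily {G : Type*} [Group G] (F : Set (Subgroup G)) : Prop :=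
  ∀ C ⊆ countableSubgroups G, IsClosedFamily C → IsDominatingFamily C → (F ∩ C).Nonempty

end IdealGSpace

open IdealGSpace

/-! Suppose both alternatives fail, with cov Δ(A_i) > n. Then n + 1 translates of A_i are pairwise
disjoint modulo I, so any finitely additive probability ν vanishing on I gives one of them, f A_i,
mass below 1/n, and hence gives some f A_j mass above 1/n. The contradiction is a family of n
translates of A_j, pairwise disjoint modulo I and each of ν-mass above 1/n.

These are found greedily. If F holds the fewer than n translating elements found so far, failure of
the second alternative provides a finite set E(F) such that every x with μ(xA_j) > 1/n has some
e⁻¹x, e ∈ E(F), outside F Δ(A_j) (`exists_finset_of_forall_ideal`). What is needed is an x with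
μ(xA_j) > 1/n and ν(e⁻¹xA_j) > 1/n for all e ∈ E(F) at once. This is the recurrence of
`exists_recurrent_null_measure`, valid along any subgroup H with P_I(H; μ) nonempty; stationarity
provides such an H closed under all the operations E.

The measure is ν = Tμ, where T lies in a minimal closed convex left ideal of operators averaging
over H-orbits. Such a T is a left zero of the ideal (`exists_comp_comp_eq_self`), so T fixes ν even
after translating it by z ∈ H. Averaging μ plus a large multiple of finitely many translates of ν,
near the supremum of ν on an orbit, then yields recurrence (`exists_forall_lt`). -/

namespace IdealGSpace

/-! ### Left zeros in compact convex left ideals of operators. -/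

open Filter Topology in
/-- A compact convex set of self-maps of a function space that absorbs precomposition with one of
its members `a` contains a solution of `x ∘ a = x`. -/
lemma exists_comp_eq_self {V α : Type*} {L : Set ((V → α → ℝ))} (hc : IsCompact L)
    (hconv : Convex ℝ L) (hne : L.Nonempty) (a : V → V) (ha : ∀ x ∈ L, x ∘ a ∈ L) :
    ∃ x ∈ L, x ∘ a = x := by
  obtain ⟨b, hb⟩ := hne
  have hit : ∀ i : ℕ, b ∘ a^[i] ∈ L := by
    intro i
    induction i with
    | zero => simpa using hb
    | succ k ih => rw [Function.iterate_succ]; exact ha _ ih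
  -- Cesàro means of the orbit of `b` under precomposition with `a`. The defect of invariance
  -- telescopes and is O(1/N), so every cluster point is invariant.
  let s : ℕ → V → α → ℝ := fun N =>
    ∑ i ∈ Finset.range (N + 1), ((N : ℝ) + 1)⁻¹ • (b ∘ a^[i])
  have hs : ∀ N, s N ∈ L := by
    intro N
    refine hconv.sum_mem (fun _ _ => by positivity) ?_ fun i _ => hit i
    rw [Finset.sum_const, Finset.card_range, nsmul_eq_mul]
    push_cast
    exact mul_inv_cancel₀ (by positivity)
  obtain ⟨x, hx, hcl⟩ := hc.exists_mapClusterPt (f := atTop) (u := s)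
    (tendsto_principal.2 (Eventually.of_forall hs))
  refine ⟨x, hx, ?_⟩
  funext u A
  let D : (V → α → ℝ) → ℝ := fun y => y (a u) A - y u A
  have hD : Continuous D := by unfold D; fun_prop
  have hDs : ∀ N, D (s N) = ((N : ℝ) + 1)⁻¹ * (b (a^[N + 1] u) A - b u A) := by
    intro N
    have h := Finset.sum_range_sub (fun i => b (a^[i] u) A) (N + 1)
    simp only [Function.iterate_zero, id] at h
    rw [← h, Finset.mul_sum]
    simp [D, s, Finset.sum_apply, ← Finset.sum_sub_distrib, mul_sub]
  obtain ⟨c, hcb⟩ : ∃ c, ∀ y ∈ L, |y u A| ≤ c := by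
    have : Continuous fun y : V → α → ℝ => |y u A| := by fun_prop
    obtain ⟨c, h⟩ := (hc.image this).bddAbove
    exact ⟨c, fun y hy => h ⟨y, hy, rfl⟩⟩
  have hlim : Tendsto (D ∘ s) atTop (𝓝 0) := by
    have h0 : Tendsto (fun N : ℕ => ((N : ℝ) + 1)⁻¹ * (2 * c)) atTop (𝓝 0) := by
      have := tendsto_one_div_add_atTop_nhds_zero_nat (𝕜 := ℝ)
      simpa using this.mul_const (2 * c)
    refine squeeze_zero_norm (fun N => ?_) h0
    rw [Function.comp_apply, hDs, Real.norm_eq_abs, abs_mul, abs_of_nonneg (by positivity)]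
    refine mul_le_mul_of_nonneg_left ?_ (by positivity)
    have h1 := hcb _ (hit (N + 1))
    have h2 := hcb _ hb
    simp only [Function.comp_apply] at h1
    calc _ ≤ |b (a^[N + 1] u) A| + |b u A| := abs_sub _ _
      _ ≤ 2 * c := by linarith
  have h1 : MapClusterPt (D x) atTop (D ∘ s) := hcl.tendsto_comp hD.continuousAt
  have h2 : ClusterPt (D x) (𝓝 0) := ClusterPt.mono h1 hlim
  have h3 : D x = 0 := eq_of_nhds_neBot h2
  simpa [D, sub_eq_zero] using h3

/-- A compact convex left ideal `L` of self-maps of a function space contains some `x` with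
`x ∘ y ∘ x = x` for all `y`: a minimal closed convex left ideal consists of left zeros. -/
lemma exists_comp_comp_eq_self {α : Type*} {S L : Set ((α → ℝ) → α → ℝ)} (hLS : L ⊆ S)
    (hc : IsCompact L) (hconv : Convex ℝ L) (hne : L.Nonempty)
    (hL : ∀ y ∈ S, ∀ x ∈ L, y ∘ x ∈ L) :
    ∃ x ∈ L, ∀ y ∈ S, x ∘ y ∘ x = x := by
  let Z : Set (Set ((α → ℝ) → α → ℝ)) :=
    {M | M ⊆ L ∧ IsClosed M ∧ Convex ℝ M ∧ M.Nonempty ∧ ∀ y ∈ S, ∀ x ∈ M, y ∘ x ∈ M}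
  obtain ⟨M, -, hM⟩ := zorn_superset_nonempty Z (by
    intro c hcZ hchain hcne
    refine ⟨⋂₀ c, ⟨?_, ?_, ?_, ?_, ?_⟩, fun s hs => Set.sInter_subset_of_mem hs⟩
    · obtain ⟨s, hs⟩ := hcne
      exact (Set.sInter_subset_of_mem hs).trans (hcZ hs).1
    · exact isClosed_sInter fun s hs => (hcZ hs).2.1
    · exact convex_sInter fun s hs => (hcZ hs).2.2.1
    · have : Nonempty c := hcne.to_subtype
      refine IsCompact.nonempty_sInter_of_directed_nonempty_isCompact_isClosed
        ?_ (fun s hs => (hcZ hs).2.2.2.1)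
        (fun s hs => hc.of_isClosed_subset (hcZ hs).2.1 (hcZ hs).1) (fun s hs => (hcZ hs).2.1)
      intro s hs t ht
      rcases hchain.total hs ht with h | h
      · exact ⟨s, hs, subset_rfl, h⟩
      · exact ⟨t, ht, h, subset_rfl⟩
    · intro y hy x hx s hs
      exact (hcZ hs).2.2.2.2 y hy x (hx s hs)) L ⟨subset_rfl, hc.isClosed, hconv, hne, hL⟩
  obtain ⟨hML, hMc, hMconv, hMne, hMS⟩ := hM.prop
  -- The solutions of `x ∘ a = x` in `M` again form a closed convex left ideal, so minimality makes
  -- them all of `M`. Closedness uses only that precomposition is continuous for pointwise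
  -- convergence.
  have key : ∀ a ∈ M, ∀ x ∈ M, x ∘ a = x := by
    intro a ha
    have hsub : {x ∈ M | x ∘ a = x} ∈ Z := by
      refine ⟨fun x hx => hML hx.1, ?_, ?_, ?_, ?_⟩
      · refine hMc.inter (isClosed_eq ?_ continuous_id)
        exact continuous_pi fun u => continuous_apply (a u)
      · intro x hx y hy p q hp hq hpq
        refine ⟨hMconv hx.1 hy.1 hp hq hpq, ?_⟩
        funext u
        have h1 := congrFun hx.2 u
        have h2 := congrFun hy.2 u
        simp only [Function.comp_apply] at h1 h2
        simp [h1, h2]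
      · obtain ⟨x, hx, hxa⟩ := exists_comp_eq_self (hc.of_isClosed_subset hMc hML) hMconv hMne a
          fun x hx => hMS x (hLS (hML hx)) a ha
        exact ⟨x, hx, hxa⟩
      · rintro y hy x ⟨hx, hxa⟩
        exact ⟨hMS y hy x hx, by rw [Function.comp_assoc, hxa]⟩
    intro x hx
    exact (hM.le_of_le hsub (fun x hx => hx.1) hx).2
  obtain ⟨x, hx⟩ := hMne
  exact ⟨x, hML hx, fun y hy => key _ (hMS y hy x hx) x hx⟩

/-! ### Averaging operators on set functions. -/

/-- Nonnegative bounded functions. -/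
def IsNonnegBdd {α : Type*} (u : α → ℝ) : Prop := ∃ b, ∀ A, 0 ≤ u A ∧ u A ≤ b

lemma IsNonnegBdd.add {α : Type*} {u v : α → ℝ} (hu : IsNonnegBdd u) (hv : IsNonnegBdd v) :
    IsNonnegBdd (u + v) := by
  obtain ⟨b, hb⟩ := hu
  obtain ⟨c, hc⟩ := hv
  exact ⟨b + c, fun A => ⟨add_nonneg (hb A).1 (hc A).1, add_le_add (hb A).2 (hc A).2⟩⟩

/-- Finite additivity of a set function. -/
def IsFinAdditive {X : Type*} (u : Set X → ℝ) : Prop :=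
  ∀ s t, Disjoint s t → u (s ∪ t) = u s + u t

/-- Operators on nonnegative bounded set functions that behave like convolution with a finitely
additive probability measure on the group `Γ`. -/
structure IsOrbitMean (Γ : Type*) [Group Γ] {X : Type*} [MulAction Γ X]
    (T : (Set X → ℝ) → Set X → ℝ) : Prop where
  eq_zero : ∀ u, ¬ IsNonnegBdd u → T u = 0
  map_add : ∀ u v, IsNonnegBdd u → IsNonnegBdd v → T (u + v) = T u + T v
  le_of : ∀ u, IsNonnegBdd u → ∀ A c, (∀ g : Γ, u (g • A) ≤ c) → T u A ≤ c
  ge_of : ∀ u, IsNonnegBdd u → ∀ A c, (∀ g : Γ, c ≤ u (g • A)) → c ≤ T u A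
  additive : ∀ u, IsNonnegBdd u → IsFinAdditive u → IsFinAdditive (T u)

namespace IsOrbitMean

variable {Γ : Type*} [Group Γ] {X : Type*} [MulAction Γ X] {T T' : (Set X → ℝ) → Set X → ℝ}

lemma bounds (hT : IsOrbitMean Γ T) {u : Set X → ℝ} {b : ℝ} (hb : ∀ A, 0 ≤ u A ∧ u A ≤ b)
    (A : Set X) : 0 ≤ T u A ∧ T u A ≤ b :=
  ⟨hT.ge_of u ⟨b, hb⟩ A 0 fun _ => (hb _).1, hT.le_of u ⟨b, hb⟩ A b fun _ => (hb _).2⟩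

lemma isNonnegBdd (hT : IsOrbitMean Γ T) {u : Set X → ℝ} (hu : IsNonnegBdd u) :
    IsNonnegBdd (T u) := by
  obtain ⟨b, hb⟩ := hu
  exact ⟨b, hT.bounds hb⟩

lemma map_zero (hT : IsOrbitMean Γ T) : T 0 = 0 := by
  funext A
  have := hT.bounds (u := 0) (b := 0) (fun _ => ⟨le_rfl, le_rfl⟩) A
  exact le_antisymm this.2 this.1

lemma comp (hT : IsOrbitMean Γ T) (hT' : IsOrbitMean Γ T') : IsOrbitMean Γ (T ∘ T') where
  eq_zero u hu := by rw [Function.comp_apply, hT'.eq_zero u hu, hT.map_zero]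
  map_add u v hu hv := by
    simp only [Function.comp_apply]
    rw [hT'.map_add u v hu hv, hT.map_add _ _ (hT'.isNonnegBdd hu) (hT'.isNonnegBdd hv)]
  le_of u hu A c h := hT.le_of _ (hT'.isNonnegBdd hu) A c fun g =>
    hT'.le_of u hu _ c fun k => by rw [smul_smul]; exact h _
  ge_of u hu A c h := hT.ge_of _ (hT'.isNonnegBdd hu) A c fun g =>
    hT'.ge_of u hu _ c fun k => by rw [smul_smul]; exact h _
  additive u hu h := hT.additive _ (hT'.isNonnegBdd hu) (hT'.additive u hu h)

lemma map_sum (hT : IsOrbitMean Γ T) {ι : Type*} (s : Finset ι) (u : ι → Set X → ℝ)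
    (hu : ∀ i, IsNonnegBdd (u i)) :
    IsNonnegBdd (∑ i ∈ s, u i) ∧ T (∑ i ∈ s, u i) = ∑ i ∈ s, T (u i) := by
  classical
  induction s using Finset.induction_on with
  | empty => exact ⟨⟨0, fun _ => ⟨le_rfl, le_rfl⟩⟩, hT.map_zero⟩
  | insert i s hi ih =>
    rw [Finset.sum_insert hi, Finset.sum_insert hi]
    exact ⟨(hu i).add ih.1, by rw [hT.map_add _ _ (hu i) ih.1, ih.2]⟩

lemma map_nsmul (hT : IsOrbitMean Γ T) (n : ℕ) {u : Set X → ℝ} (hu : IsNonnegBdd u) :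
    IsNonnegBdd (n • u) ∧ T (n • u) = n • T u := by
  have := hT.map_sum (Finset.range n) (fun _ => u) fun _ => hu
  simpa using this

open Classical in
/-- Translation by a group element, as an operator on set functions. -/
noncomputable def translate (X : Type*) [MulAction Γ X] (z : Γ) : (Set X → ℝ) → Set X → ℝ :=
  fun u => if IsNonnegBdd u then fun A => u (z • A) else 0

lemma translate_apply (z : Γ) {u : Set X → ℝ} (hu : IsNonnegBdd u) (A : Set X) :
    translate X z u A = u (z • A) := by
  simp [translate, hu]

lemma isOrbitMean_translate (z : Γ) : IsOrbitMean Γ (translate X z) where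
  eq_zero u hu := by simp [translate, hu]
  map_add u v hu hv := by
    funext A
    simp [translate_apply, hu, hv, hu.add hv]
  le_of u hu A c h := by rw [translate_apply z hu]; exact h z
  ge_of u hu A c h := by rw [translate_apply z hu]; exact h z
  additive u hu h s t hst := by
    simp only [translate_apply z hu, Set.smul_set_union]
    exact h _ _ ((Set.disjoint_image_iff (MulAction.injective _)).2 hst)

-- Every defining condition is closed for pointwise convergence, and each value `T u A` is confined
-- to a compact interval depending on `u`; Tychonoff applies. The value 0 at unbounded or signed `u`
-- is what confines those coordinates.
variable (Γ X) in
lemma isCompact_setOf : IsCompact {T : (Set X → ℝ) → Set X → ℝ | IsOrbitMean Γ T} := by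
  classical
  let B : (Set X → ℝ) → ℝ := fun u => if h : IsNonnegBdd u then h.choose else 0
  have hK : IsCompact (Set.univ.pi fun u : Set X → ℝ => Set.univ.pi fun _ : Set X =>
      Set.Icc 0 (B u)) :=
    isCompact_univ_pi fun u => isCompact_univ_pi fun _ => isCompact_Icc
  refine hK.of_isClosed_subset ?_ ?_
  · have : {T : (Set X → ℝ) → Set X → ℝ | IsOrbitMean Γ T} =
        {T | ∀ u, ¬ IsNonnegBdd u → T u = 0} ∩
        {T | ∀ u v, IsNonnegBdd u → IsNonnegBdd v → T (u + v) = T u + T v} ∩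
        {T | ∀ u, IsNonnegBdd u → ∀ A c, (∀ g : Γ, u (g • A) ≤ c) → T u A ≤ c} ∩
        {T | ∀ u, IsNonnegBdd u → ∀ A c, (∀ g : Γ, c ≤ u (g • A)) → c ≤ T u A} ∩
        {T | ∀ u, IsNonnegBdd u → IsFinAdditive u → ∀ s t, Disjoint s t →
          T u (s ∪ t) = T u s + T u t} := by
      ext T
      exact ⟨fun h => ⟨⟨⟨⟨h.1, h.2⟩, h.3⟩, h.4⟩, h.5⟩,
        fun h => ⟨h.1.1.1.1, h.1.1.1.2, h.1.1.2, h.1.2, h.2⟩⟩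
    rw [this]
    simp only [Set.ofPred_forall]
    refine ((((?_ : IsClosed _).inter ?_).inter ?_).inter ?_).inter ?_
    all_goals
      repeat' refine isClosed_iInter fun _ => ?_
      first
        | exact isClosed_eq (by fun_prop) (by fun_prop)
        | exact isClosed_le (by fun_prop) (by fun_prop)
  · intro T hT u _ A _
    by_cases h : IsNonnegBdd u
    · simp only [B, h, dif_pos]
      exact hT.bounds h.choose_spec A
    · simp [B, h, hT.eq_zero u h]

lemma isClosed_setOf_apply_eq_zero (u : Set X → ℝ) (J : Set (Set X)) :
    IsClosed {T : (Set X → ℝ) → Set X → ℝ | ∀ A ∈ J, T u A = 0} := by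
  simp only [Set.ofPred_forall]
  exact isClosed_iInter fun _ => isClosed_iInter fun _ => isClosed_eq (by fun_prop) (by fun_prop)

variable (Γ X) in
lemma convex_setOf : Convex ℝ {T : (Set X → ℝ) → Set X → ℝ | IsOrbitMean Γ T} := by
  intro T hT T' hT' p q hp hq hpq
  refine ⟨fun u hu => ?_, fun u v hu hv => ?_, fun u hu A c h => ?_, fun u hu A c h => ?_,
    fun u hu h s t hst => ?_⟩
  · simp [hT.eq_zero u hu, hT'.eq_zero u hu]
  · simp only [Pi.add_apply, Pi.smul_apply, hT.map_add u v hu hv, hT'.map_add u v hu hv, smul_add]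
    abel
  · have h1 := mul_le_mul_of_nonneg_left (hT.le_of u hu A c h) hp
    have h2 := mul_le_mul_of_nonneg_left (hT'.le_of u hu A c h) hq
    have h3 : p * c + q * c = c := by rw [← add_mul, hpq, one_mul]
    simp only [Pi.add_apply, Pi.smul_apply, smul_eq_mul]
    linarith
  · have h1 := mul_le_mul_of_nonneg_left (hT.ge_of u hu A c h) hp
    have h2 := mul_le_mul_of_nonneg_left (hT'.ge_of u hu A c h) hq
    have h3 : p * c + q * c = c := by rw [← add_mul, hpq, one_mul]
    simp only [Pi.add_apply, Pi.smul_apply, smul_eq_mul]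
    linarith
  · simp only [Pi.add_apply, Pi.smul_apply, smul_eq_mul, hT.additive u hu h s t hst,
      hT'.additive u hu h s t hst]
    ring

/-- If some orbit mean sends `u` to a function vanishing on an invariant family `J`, then so does
one that moreover satisfies `T (z • T u) = T u` for all `z`. -/
lemma exists_apply_translate_eq {u : Set X → ℝ} {J : Set (Set X)}
    (hJ : ∀ g : Γ, ∀ A ∈ J, g • A ∈ J) (hu : IsNonnegBdd u)
    (h : ∃ T, IsOrbitMean Γ T ∧ ∀ A ∈ J, T u A = 0) :
    ∃ T, IsOrbitMean Γ T ∧ (∀ A ∈ J, T u A = 0) ∧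
      ∀ z : Γ, T (fun A => T u (z • A)) = T u := by
  -- The operators killing `u` on `J` form a left ideal: `T (T' u) A` averages `T' u` over the orbit
  -- of `A`, which stays in `J`.
  obtain ⟨T, ⟨hT, hTJ⟩, hTT⟩ := exists_comp_comp_eq_self
    (S := {T : (Set X → ℝ) → Set X → ℝ | IsOrbitMean Γ T})
    (L := {T | IsOrbitMean Γ T} ∩ {T | ∀ A ∈ J, T u A = 0}) Set.inter_subset_left
    ((isCompact_setOf Γ X).inter_right (isClosed_setOf_apply_eq_zero u J))
    ((convex_setOf Γ X).inter (by
      intro T hT T' hT' p q _ _ _ A hA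
      simp [hT A hA, hT' A hA])) h (by
    rintro T hT T' ⟨hT', h0⟩
    refine ⟨hT.comp hT', fun A hA => le_antisymm ?_ ?_⟩
    · exact hT.le_of _ (hT'.isNonnegBdd hu) A 0 fun g => (h0 _ (hJ g A hA)).le
    · exact hT.ge_of _ (hT'.isNonnegBdd hu) A 0 fun g => (h0 _ (hJ g A hA)).ge)
  refine ⟨T, hT, hTJ, fun z => ?_⟩
  have := congrFun (hTT _ (isOrbitMean_translate z)) u
  have e : translate X z (T u) = fun A => T u (z • A) :=
    funext fun A => translate_apply z (hT.isNonnegBdd hu) A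
  simpa [Function.comp_apply, e] using this

/-- Recurrence: if `ν = T u` is left unchanged by averaging its translates with `T`, and `ν` exceeds
`r` at `A`, then at some translate of `A` all of `u` and finitely many translates of `ν` exceed
`r`. -/
lemma exists_forall_lt (hT : IsOrbitMean Γ T) {u : Set X → ℝ} (hu : ∀ A, 0 ≤ u A ∧ u A ≤ 1)
    (hTT : ∀ z : Γ, T (fun A => T u (z • A)) = T u) {r : ℝ} (hr : 0 ≤ r) {A : Set X}
    (hA : r < T u A) (Z : Finset Γ) :
    ∃ y : Γ, r < u (y • A) ∧ ∀ z ∈ Z, r < T u (z • y • A) := by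
  classical
  have hb := hT.bounds hu
  set ν := T u with hν
  have hbdd : BddAbove (Set.range fun g : Γ => ν (g • A)) :=
    ⟨1, by rintro _ ⟨g, rfl⟩; exact (hb _).2⟩
  set s := ⨆ g : Γ, ν (g • A) with hs
  have hle : ∀ g : Γ, ν (g • A) ≤ s := fun g => le_ciSup hbdd g
  have hrs : r < s := hA.trans_le (by simpa using hle 1)
  -- With this weight, one translate of `ν` dropping from `s` to `r` outweighs the largest possible
  -- value 1 of `u`.
  obtain ⟨C, hC⟩ := exists_nat_ge (1 / (s - r))
  have hC' : 1 ≤ C * (s - r) := (div_le_iff₀ (sub_pos.2 hrs)).1 hC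
  set K : ℝ := C * Z.card with hK
  have hK0 : 0 ≤ K := by positivity
  -- The total weight is `1 + K`, so this margin costs only `(s - r) / 2` after averaging, less than
  -- the gap `s - r` between `s * (1 + K)` and the bound `r + K * s` below.
  obtain ⟨g, hg⟩ := exists_lt_of_lt_ciSup
    (show s - (s - r) / (2 * (1 + K)) < ⨆ g : Γ, ν (g • A) from
      sub_lt_self _ (div_pos (sub_pos.2 hrs) (by positivity)))
  have hνb : ∀ z : Γ, IsNonnegBdd fun B => ν (z • B) := fun z => ⟨1, fun B => hb _⟩
  have hsum := hT.map_sum Z (fun z B => ν (z • B)) hνb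
  have hmul := hT.map_nsmul C hsum.1
  have hadd := hT.map_add u _ ⟨1, hu⟩ hmul.1
  have hval : T (u + C • ∑ z ∈ Z, fun B => ν (z • B)) (g • A) = ν (g • A) * (1 + K) := by
    rw [hadd, hmul.2, hsum.2, Finset.sum_congr rfl fun z _ => hTT z]
    simp [hK, ← hν]
    ring
  by_contra! hcon
  have hup : T (u + C • ∑ z ∈ Z, fun B => ν (z • B)) (g • A) ≤ r + K * s := by
    refine hT.le_of _ (IsNonnegBdd.add ⟨1, hu⟩ hmul.1) _ _ fun h => ?_
    simp only [Pi.add_apply, Pi.smul_apply, Finset.sum_apply]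
    rw [nsmul_eq_mul]
    have hz : ∀ z : Γ, ν (z • h • g • A) ≤ s := fun z => by
      rw [smul_smul, smul_smul]; exact hle _
    -- If `u` exceeds `r` here, some translate of `ν` is at most `r` and the choice of `C`
    -- compensates; otherwise `u` itself is at most `r`.
    by_cases h1 : r < u (h • g • A)
    · obtain ⟨z, hzZ, hzr⟩ := hcon (h * g) (by rwa [mul_smul])
      rw [mul_smul] at hzr
      have hS : ∑ z ∈ Z, ν (z • h • g • A) ≤ r + (Z.card - 1) * s := by
        rw [← Finset.add_sum_erase Z _ hzZ]
        refine add_le_add hzr ?_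
        refine (Finset.sum_le_card_nsmul _ _ s fun z _ => hz z).trans ?_
        rw [nsmul_eq_mul, Finset.card_erase_of_mem hzZ, Nat.cast_sub (Finset.card_pos.2 ⟨z, hzZ⟩)]
        simp
      have h2 := (hu (h • g • A)).2
      have h3 := mul_le_mul_of_nonneg_left hS (Nat.cast_nonneg (α := ℝ) C)
      rw [hK]
      linarith
    · have hS : ∑ z ∈ Z, ν (z • h • g • A) ≤ Z.card * s := by
        simpa using Finset.sum_le_card_nsmul _ _ s fun z _ => hz z
      have h3 := mul_le_mul_of_nonneg_left hS (Nat.cast_nonneg (α := ℝ) C)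
      rw [hK]
      linarith [not_lt.1 h1]
  rw [hval] at hup
  have h1 : (s - (s - r) / (2 * (1 + K))) * (1 + K) < ν (g • A) * (1 + K) :=
    mul_lt_mul_of_pos_right hg (by positivity)
  have h2 : (s - (s - r) / (2 * (1 + K))) * (1 + K) = s * (1 + K) - (s - r) / 2 := by
    field_simp
  linarith

end IsOrbitMean

/-! ### Integration and convolution as averaging operators. -/

namespace FinAddProb

lemma integral_le {X : Type*} (m : FinAddProb X) {f : X → ℝ} {a b : ℝ} (ha : ∀ x, a ≤ f x)
    (hb : ∀ x, f x ≤ b) : m.integral f ≤ b :=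
  csSup_le ⟨a, m.mem_lowerSums_of_le ha⟩ fun _ hr => m.lowerSums_le hb hr

lemma le_integral {X : Type*} (m : FinAddProb X) {f : X → ℝ} {a b : ℝ} (ha : ∀ x, a ≤ f x)
    (hb : ∀ x, f x ≤ b) : a ≤ m.integral f :=
  le_csSup (m.bddAbove_lowerSums hb) (m.mem_lowerSums_of_le ha)

lemma dirac_apply {X : Type*} (a : X) (s : Set X) [Decidable (a ∈ s)] :
    dirac a s = if a ∈ s then 1 else 0 := by
  change @ite ℝ≥0 (a ∈ s) (Classical.propDecidable _) 1 0 = _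
  congr

lemma integral_dirac {X : Type*} (a : X) {f : X → ℝ} {b c : ℝ} (hb : ∀ x, b ≤ f x)
    (hc : ∀ x, f x ≤ c) : (dirac a).integral f = f a := by
  classical
  have hval : ∀ {ι : Type} [Fintype ι] (p : X → ι) (d : ι → ℝ),
      (dirac a).simpleSum p d = d (p a) := by
    intro ι _ p d
    simp only [simpleSum, dirac_apply, Set.mem_preimage, Set.mem_singleton_iff]
    rw [Finset.sum_eq_single (p a)]
    · simp
    · intro i _ hi
      simp [Ne.symm hi]
    · simp
  apply le_antisymm
  · refine csSup_le ⟨b, mem_lowerSums_of_le _ hb⟩ ?_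
    rintro _ ⟨ι, _, p, d, hd, rfl⟩
    rw [hval]
    exact hd a
  · refine le_csSup (bddAbove_lowerSums _ hc)
      ⟨Bool, inferInstance, fun x => decide (x = a), fun i => if i then f a else b, fun x => ?_, ?_⟩
    · by_cases h : x = a
      · simp [h]
      · simpa [h] using hb x
    · rw [hval]
      simp

section Conv

variable {Γ : Type*} [Group Γ] {X : Type*} [MulAction Γ X]

lemma conv_apply (l : FinAddProb Γ) (m : FinAddProb X) (A : Set X) :
    (l.conv m A : ℝ) = l.integral fun g => (m (g⁻¹ • A) : ℝ) := rfl

lemma dirac_one_conv_apply (m : FinAddProb X) (A : Set X) :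
    ((dirac (1 : Γ)).conv m A : ℝ) = m A := by
  rw [conv_apply, integral_dirac (b := 0) (c := 1) _ (fun _ => NNReal.coe_nonneg _)
    (fun _ => by exact_mod_cast m.le_one _)]
  simp

open Classical in
/-- Convolution with a measure on the group, as an operator on set functions. -/
noncomputable def convOp (X : Type*) [MulAction Γ X] (l : FinAddProb Γ) :
    (Set X → ℝ) → Set X → ℝ :=
  fun u => if IsNonnegBdd u then fun A => l.integral fun g => u (g⁻¹ • A) else 0

lemma convOp_apply (l : FinAddProb Γ) {u : Set X → ℝ} (hu : IsNonnegBdd u) (A : Set X) :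
    l.convOp X u A = l.integral fun g => u (g⁻¹ • A) := by
  simp [convOp, hu]

lemma isOrbitMean_convOp (l : FinAddProb Γ) : IsOrbitMean Γ (l.convOp X) where
  eq_zero u hu := by simp [convOp, hu]
  map_add u v hu hv := by
    funext A
    rw [Pi.add_apply, convOp_apply l hu, convOp_apply l hv, convOp_apply l (hu.add hv)]
    obtain ⟨b, hb⟩ := hu
    obtain ⟨c, hc⟩ := hv
    exact l.integral_add (fun _ => (hb _).1) (fun _ => (hb _).2) (fun _ => (hc _).1)
      (fun _ => (hc _).2)
  le_of u hu A c h := by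
    rw [convOp_apply l hu]
    obtain ⟨b, hb⟩ := hu
    exact l.integral_le (fun _ => (hb _).1) fun g => h _
  ge_of u hu A c h := by
    rw [convOp_apply l hu]
    obtain ⟨b, hb⟩ := hu
    exact l.le_integral (fun g => h _) (fun _ => (hb _).2)
  additive u hu h s t hst := by
    simp only [convOp_apply l hu]
    obtain ⟨b, hb⟩ := hu
    have : ∀ g : Γ, u (g⁻¹ • (s ∪ t)) = u (g⁻¹ • s) + u (g⁻¹ • t) := fun g => by
      rw [Set.smul_set_union]
      exact h _ _ ((Set.disjoint_image_iff (MulAction.injective _)).2 hst)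
    simp only [this]
    exact l.integral_add (fun _ => (hb _).1) (fun _ => (hb _).2) (fun _ => (hb _).1)
      (fun _ => (hb _).2)

end Conv

end FinAddProb

/-! ### The recurrent null measure. -/

/-- If `P_I(H; μ)` is nonempty, there is a finitely additive probability measure `ν` vanishing on
`I` that recurs along `H` simultaneously with `μ`. -/
lemma exists_recurrent_null_measure {G : Type*} [Group G] {X : Type*} [MulAction G X]
    {I : Order.Ideal (Set X)} (hGI : IsGInvariant G I) {μ : FinAddProb X} {H : Subgroup G}
    (hH : (convNullMeasures I H μ).Nonempty) :
    ∃ ν : Set X → ℝ, (∀ A, 0 ≤ ν A) ∧ ν Set.univ = 1 ∧ IsFinAdditive ν ∧ (∀ A ∈ I, ν A = 0) ∧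
      ∀ r : ℝ, 0 ≤ r → ∀ A, r < ν A → ∀ Z : Finset G, (∀ z ∈ Z, z ∈ H) →
        ∃ y ∈ H, r < μ (y • A) ∧ ∀ z ∈ Z, r < ν (z • y • A) := by
  classical
  obtain ⟨l, hl⟩ := hH
  set u : Set X → ℝ := fun A => (μ A : ℝ) with hu
  have hu1 : ∀ A, 0 ≤ u A ∧ u A ≤ 1 := fun A =>
    ⟨NNReal.coe_nonneg _, by exact_mod_cast μ.le_one _⟩
  have hub : IsNonnegBdd u := ⟨1, hu1⟩
  have huniv : u Set.univ = 1 := by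
    have h : μ (Set.univ : Set X) = 1 := μ.univ'
    simp [hu, h]
  -- Convolution with `l` starts the construction: since δ₁ * μ = μ, the case x = 1 of membership in
  -- P_I(H; μ) says that it sends μ to a function vanishing on `I`.
  obtain ⟨T, hT, hTI, hTT⟩ := IsOrbitMean.exists_apply_translate_eq (Γ := H) (J := (I : Set (Set X)))
    (fun g A hA => hGI g A hA) hub ⟨l.convOp X, l.isOrbitMean_convOp, fun A hA => by
      have h : l.conv ((FinAddProb.dirac (1 : H)).conv μ) A = 0 := hl 1 A hA
      rw [← NNReal.coe_inj, FinAddProb.conv_apply] at h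
      simp only [FinAddProb.dirac_one_conv_apply] at h
      rw [FinAddProb.convOp_apply l hub]
      exact h⟩
  refine ⟨T u, fun A => (hT.bounds hu1 A).1, ?_, hT.additive u hub fun s t hst => ?_, hTI,
    fun r hr A hA Z hZ => ?_⟩
  · exact le_antisymm (hT.bounds hu1 _).2
      (hT.ge_of u hub _ 1 fun g => by rw [Set.smul_set_univ, huniv])
  · simp [hu, μ.union hst]
  · obtain ⟨y, hy, hyZ⟩ := hT.exists_forall_lt hu1 hTT hr hA (Z.subtype (· ∈ H))
    exact ⟨y, y.2, hy, fun z hz => hyZ ⟨z, hZ z hz⟩ (by simpa using hz)⟩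

/-! ### Measures of sets disjoint modulo the ideal. -/

section AlmostDisjoint

variable {X : Type*} {I : Order.Ideal (Set X)} {ν : Set X → ℝ}

lemma IsFinAdditive.apply_union (hν : IsFinAdditive ν) (hI : ∀ A ∈ I, ν A = 0) {s t : Set X} (hst : s ∩ t ∈ I) : ν (s ∪ t) = ν s + ν t := by
  have h1 := hν s (t \ s) Set.disjoint_sdiff_right
  have h2 := hν (s ∩ t) (t \ s) (Set.disjoint_sdiff_right.mono_left Set.inter_subset_left)
  rw [Set.union_sdiff_self] at h1
  rw [hI _ hst, zero_add] at h2
  rw [h1, ← h2]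
  congr 2
  ext x
  by_cases h : x ∈ s <;> simp [h]

lemma IsFinAdditive.le_one (hν : IsFinAdditive ν) (h0 : ∀ A, 0 ≤ ν A) (h1 : ν Set.univ = 1)
    (s : Set X) : ν s ≤ 1 := by
  have := hν s sᶜ disjoint_compl_right
  rw [Set.union_compl_self, h1] at this
  linarith [h0 sᶜ]

/-- A measure vanishing on `I` gives total mass at most one to sets that are pairwise disjoint
modulo `I`. -/
lemma IsFinAdditive.sum_le_one (hν : IsFinAdditive ν) (h0 : ∀ A, 0 ≤ ν A) (h1 : ν Set.univ = 1)
    (hI : ∀ A ∈ I, ν A = 0) {l : List (Set X)} (hl : l.Pairwise fun s t => s ∩ t ∈ I) :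
    (l.map ν).sum ≤ 1 := by
  -- The second conjunct is carried through the induction to make the head almost disjoint from the
  -- union of the tail.
  have key : ∀ l : List (Set X), l.Pairwise (fun s t => s ∩ t ∈ I) →
      ν (l.foldr (· ∪ ·) ∅) = (l.map ν).sum ∧
        ∀ s, (∀ t ∈ l, s ∩ t ∈ I) → s ∩ l.foldr (· ∪ ·) ∅ ∈ I := by
    intro l hl
    induction l with
    | nil => exact ⟨by simpa using hI _ I.bot_mem, fun s _ => by simpa using I.bot_mem⟩
    | cons a l ih =>
      obtain ⟨ha, hl⟩ := List.pairwise_cons.1 hl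
      obtain ⟨ih1, ih2⟩ := ih hl
      refine ⟨?_, fun s hs => ?_⟩
      · rw [List.foldr_cons, List.map_cons, List.sum_cons, hν.apply_union hI (ih2 a ha), ih1]
      · rw [List.foldr_cons, Set.inter_union_distrib_left]
        exact Order.Ideal.sup_mem (hs a (by simp)) (ih2 s fun t ht => hs t (by simp [ht]))
  rw [← (key l hl).1]
  exact hν.le_one h0 h1 _

lemma IsFinAdditive.sum_partition (hν : IsFinAdditive ν) {ι : Type*} [Fintype ι]
    {A : ι → Set X} (hdisj : Pairwise fun i j => Disjoint (A i) (A j)) :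
    ν (⋃ i, A i) = ∑ i, ν (A i) := by
  classical
  have h0 : ν ∅ = 0 := by
    have := hν ∅ ∅ (Set.disjoint_empty _)
    rw [Set.union_empty] at this
    linarith
  have : ∀ s : Finset ι, ν (⋃ i ∈ s, A i) = ∑ i ∈ s, ν (A i) := by
    intro s
    induction s using Finset.induction_on with
    | empty => simpa using h0
    | insert i s hi ih =>
      rw [Finset.set_biUnion_insert, hν, ih, Finset.sum_insert hi]
      rw [Set.disjoint_iUnion₂_right]
      intro j hj
      exact hdisj (by rintro rfl; exact hi hj)
  simpa using this Finset.univ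

end AlmostDisjoint

/-! ### Difference sets, covering numbers and generated ideals. -/

section DiffSet

variable {G : Type*} [Group G] {X : Type*} [MulAction G X] {I : Order.Ideal (Set X)}

/-- Translates `g A` and `f A` are disjoint modulo `I` when `g ∉ f Δ(A)`. -/
lemma smul_inter_smul_mem (hGI : IsGInvariant G I) {A : Set X} {f g : G}
    (h : f⁻¹ * g ∉ diffSet G I A) : g • A ∩ f • A ∈ I := by
  have h1 : (f⁻¹ * g) • A ∩ A ∈ I := by simpa [diffSet] using h
  have := hGI f _ h1
  rwa [Set.smul_set_inter, smul_smul, mul_inv_cancel_left] at this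

/-- A list of `f` with the `f A` pairwise disjoint modulo `I` extends by any `g ∉ F Δ(A)`, where
`F` is its set of members. -/
lemma pairwise_cons_of_notMem (hGI : IsGInvariant G I) [DecidableEq G] {A : Set X} {l : List G}
    (hl : (l.map fun f => f • A).Pairwise fun s t => s ∩ t ∈ I) {g : G}
    (hg : g ∉ (l.toFinset : Set G) * diffSet G I A) :
    ((g :: l).map fun f => f • A).Pairwise fun s t => s ∩ t ∈ I := by
  rw [List.map_cons, List.pairwise_cons]
  refine ⟨fun t ht => ?_, hl⟩
  obtain ⟨f, hf, rfl⟩ := List.mem_map.1 ht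
  refine smul_inter_smul_mem hGI fun h => hg ?_
  exact ⟨f, by simpa using hf, f⁻¹ * g, h, by simp⟩

lemma cov_le_card {B : Set G} {F : Finset G} (h : (F : Set G) * B = Set.univ) :
    cov B ≤ (F.card : WithTop Cardinal) := by
  refine (iInf₂_le (F : Set G) h).trans ?_
  simp

/-- If `cov Δ(A) > n`, there are `n + 1` translates of `A` pairwise disjoint modulo `I`. -/
lemma exists_list_of_lt_cov (hGI : IsGInvariant G I) {A : Set X} {n : ℕ}
    (h : ¬ cov (diffSet G I A) ≤ (n : WithTop Cardinal)) :
    ∃ l : List G, l.length = n + 1 ∧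
      (l.map fun f => f • A).Pairwise fun s t => s ∩ t ∈ I := by
  classical
  have : ∀ k ≤ n + 1, ∃ l : List G, l.length = k ∧
      (l.map fun f => f • A).Pairwise fun s t => s ∩ t ∈ I := by
    intro k
    induction k with
    | zero => exact fun _ => ⟨[], by simp⟩
    | succ k ih =>
      intro hk
      obtain ⟨l, hlk, hl⟩ := ih (by omega)
      -- The current list has at most `n` entries, too few to cover, so length `n + 1` is reached.
      obtain ⟨g, hg⟩ : ∃ g, g ∉ (l.toFinset : Set G) * diffSet G I A := by
        by_contra! hcon
        refine h ((cov_le_card (Set.eq_univ_of_forall hcon)).trans ?_)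
        have := l.toFinset_card_le
        exact_mod_cast this.trans (by omega)
      exact ⟨g :: l, by simp [hlk], pairwise_cons_of_notMem hGI hl hg⟩
  exact this (n + 1) le_rfl

/-- The `G`-invariant ideal generated by a set `N`: the sets covered by finitely many translates
of `N`. -/
def translateIdeal (N : Set G) : Order.Ideal (Set G) where
  carrier := {B | ∃ E : Finset G, B ⊆ ⋃ e ∈ E, e • N}
  lower' := by
    rintro B C hCB ⟨E, hE⟩
    exact ⟨E, Set.Subset.trans hCB hE⟩
  nonempty' := ⟨∅, ∅, Set.empty_subset _⟩
  directed' := by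
    classical
    rintro B ⟨E, hE⟩ C ⟨F, hF⟩
    refine ⟨B ∪ C, ⟨E ∪ F, ?_⟩, Set.subset_union_left, Set.subset_union_right⟩
    rw [Finset.set_biUnion_union]
    exact Set.union_subset_union hE hF

lemma self_mem_translateIdeal (N : Set G) : N ∈ translateIdeal N :=
  ⟨{1}, by simp⟩

lemma isGInvariant_translateIdeal (N : Set G) : IsGInvariant G (translateIdeal N) := by
  classical
  rintro g B ⟨E, hE⟩
  refine ⟨E.image (g * ·), ?_⟩
  rw [Finset.set_biUnion_finset_image]
  rintro _ ⟨b, hb, rfl⟩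
  obtain ⟨e, he, hbe⟩ := Set.mem_iUnion₂.1 (hE hb)
  refine Set.mem_iUnion₂.2 ⟨e, he, ?_⟩
  rw [mul_smul]
  exact Set.smul_mem_smul_set hbe

lemma covIdeal_le_card {J : Order.Ideal (Set G)} {B : Set G} {F : Finset G}
    (h : ((F : Set G) * B)ᶜ ∈ J) : covIdeal J B ≤ (F.card : WithTop Cardinal) := by
  refine (iInf₂_le (F : Set G) ?_).trans ?_
  · change symmDiff ((F : Set G) * B) Set.univ ∈ J
    rwa [← Set.top_eq_univ, symmDiff_top]
  · simp

/-- If no invariant proper ideal `J ∌ S` has `cov_J B < n`, then for every `F` with fewer than `n`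
elements, `S` is covered by finitely many translates of the complement of `F B`. -/
lemma exists_finset_of_forall_ideal {S B : Set G} {n : ℕ}
    (h : ¬ ∃ J : Order.Ideal (Set G), J.IsProper ∧ IsGInvariant G J ∧ S ∉ J ∧
      covIdeal J B < (n : WithTop Cardinal)) {F : Finset G} (hF : F.card < n) :
    ∃ E : Finset G, ∀ y ∈ S, ∃ e ∈ E, e⁻¹ * y ∉ (F : Set G) * B := by
  -- Modulo this ideal `F * B` is everything, so its covering number is at most `F.card < n`. Were
  -- `S` outside it, it would be proper and of the excluded kind.
  have hS : S ∈ translateIdeal ((F : Set G) * B)ᶜ := by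
    by_contra hS
    refine h ⟨_, Order.Ideal.isProper_of_notMem hS, isGInvariant_translateIdeal _, hS,
      (covIdeal_le_card (self_mem_translateIdeal _)).trans_lt ?_⟩
    exact_mod_cast hF
  obtain ⟨E, hE⟩ := hS
  refine ⟨E, fun y hy => ?_⟩
  obtain ⟨e, he, hye⟩ := Set.mem_iUnion₂.1 (hE hy)
  exact ⟨e, he, by simpa [Set.mem_smul_set_iff_inv_smul_mem] using hye⟩

end DiffSet

/-! ### Countable subgroups closed under finitary operations. -/

section ClosedSubgroups

variable {G : Type*} [Group G]

lemma countable_closure_of_countable {s : Set G} (hs : s.Countable) :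
    Countable (Subgroup.closure s) := by
  have := hs.to_subtype
  have h := FreeGroup.range_lift_eq_closure (f := ((↑) : s → G))
  rw [Subtype.range_coe] at h
  rw [← h]
  exact (Set.countable_range _).to_subtype

/-- The countable subgroups containing a finite set `F₀` and closed under finite-set-valued
operations on finite sets. -/
def closedSubgroups {ι : Type*} (F₀ : Finset G) (E : ι → Finset G → Finset G) :
    Set (Subgroup G) :=
  {H | Countable H ∧ (F₀ : Set G) ⊆ H ∧
    ∀ i (F : Finset G), (F : Set G) ⊆ H → (E i F : Set G) ⊆ H}

lemma exists_subset_of_subset_iUnion {s : ℕ → Subgroup G} (hs : Monotone s) (F : Finset G)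
    (hF : (F : Set G) ⊆ ⋃ k, (s k : Set G)) : ∃ k, (F : Set G) ⊆ s k := by
  have hdir : Directed (· ⊆ ·) fun k => (s k : Set G) :=
    Monotone.directed_le fun _ _ h => hs h
  exact hdir.exists_mem_subset_of_finset_subset_biUnion hF

/-- The closure conditions are finitary: a finite subset of an increasing union already lies in one
term. -/
lemma isClosedFamily_closedSubgroups {ι : Type*} (F₀ : Finset G) (E : ι → Finset G → Finset G) :
    IsClosedFamily (closedSubgroups F₀ E) := by
  intro s hs hsC K hK
  refine ⟨?_, ?_, fun i F hF => ?_⟩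
  · have : (K : Set G).Countable := by
      rw [hK]
      exact Set.countable_iUnion fun k => Set.countable_coe_iff.1 (hsC k).1
    exact this.to_subtype
  · rw [hK]
    exact (hsC 0).2.1.trans (Set.subset_iUnion (fun k => (s k : Set G)) 0)
  · rw [hK] at hF ⊢
    obtain ⟨k, hk⟩ := exists_subset_of_subset_iUnion hs F hF
    exact ((hsC k).2.2 i F hk).trans (Set.subset_iUnion (fun k => (s k : Set G)) k)

/-- Saturation in ω steps. Each step stays countable because a countable group has countably many
finite subsets and `ι` is countable. -/
lemma isDominatingFamily_closedSubgroups {ι : Type*} [Countable ι] (F₀ : Finset G)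
    (E : ι → Finset G → Finset G) : IsDominatingFamily (closedSubgroups F₀ E) := by
  intro H hH
  let next : Subgroup G → Subgroup G := fun K => Subgroup.closure
    ((K : Set G) ∪ ⋃ i, ⋃ F ∈ {F : Finset G | (F : Set G) ⊆ K}, (E i F : Set G))
  let s : ℕ → Subgroup G := fun k => next^[k] (Subgroup.closure ((H : Set G) ∪ F₀))
  have hsucc : ∀ k, s (k + 1) = next (s k) := fun k => Function.iterate_succ_apply' _ _ _
  have hmono : Monotone s := monotone_nat_of_le_succ fun k => by
    rw [hsucc]
    exact fun x hx => Subgroup.subset_closure (Or.inl hx)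
  have hcount : ∀ k, Countable (s k) := by
    intro k
    induction k with
    | zero =>
      exact countable_closure_of_countable
        ((Set.countable_coe_iff.1 hH).union F₀.countable_toSet)
    | succ k ih =>
      rw [hsucc]
      refine countable_closure_of_countable ((Set.countable_coe_iff.1 ih).union ?_)
      refine Set.countable_iUnion fun i => Set.Countable.biUnion ?_ fun F _ => (E i F).countable_toSet
      have hfin := (Set.countable_ofPred_finite_subset (Set.countable_coe_iff.1 ih)).preimage
        (Finset.coe_injective (α := G))
      exact hfin.mono fun F hF => And.intro F.finite_toSet hF
  have hK : ((⨆ k, s k : Subgroup G) : Set G) = ⋃ k, (s k : Set G) :=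
    Subgroup.coe_iSup_of_directed hmono.directed_le
  refine ⟨⨆ k, s k, ⟨?_, ?_, fun i F hF => ?_⟩, ?_⟩
  · have : ((⨆ k, s k : Subgroup G) : Set G).Countable := by
      rw [hK]
      exact Set.countable_iUnion fun k => Set.countable_coe_iff.1 (hcount k)
    exact this.to_subtype
  · exact fun x hx => le_iSup s 0 (Subgroup.subset_closure (Or.inr hx))
  · rw [hK] at hF
    obtain ⟨k, hk⟩ := exists_subset_of_subset_iUnion hmono F hF
    intro x hx
    refine le_iSup s (k + 1) ?_
    rw [hsucc]
    exact Subgroup.subset_closure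
      (Or.inr (Set.mem_iUnion.2 ⟨i, Set.mem_iUnion₂.2 ⟨F, hk, hx⟩⟩))
  · exact fun x hx => le_iSup s 0 (Subgroup.subset_closure (Or.inl hx))

end ClosedSubgroups

end IdealGSpace

/-! ### The greedy construction and the contradiction. -/

theorem theorem5 {G : Type*} [Group G] {X : Type*} [MulAction G X]
    (I : Order.Ideal (Set X)) (hI : I.IsProper) (hGI : IsGInvariant G I)
    (μ : FinAddProb X)
    (hμ : IsStationaryFamily
      {H : Subgroup G | H ∈ countableSubgroups G ∧ (convNullMeasures I H μ).Nonempty})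
    (n : ℕ) (A : Fin n → Set X) (hdisj : Pairwise fun i j => Disjoint (A i) (A j))
    (hA : ⋃ i, A i = Set.univ) :
    (∀ i, cov (diffSet G I (A i)) ≤ (n : WithTop Cardinal)) ∨
    ∃ i, ∃ J : Order.Ideal (Set G), J.IsProper ∧ IsGInvariant G J ∧
      {x : G | (μ (x • A i) : ℝ) > 1 / (n : ℝ)} ∉ J ∧
      covIdeal J (diffSet G I (A i)) < (n : WithTop Cardinal) := by
  classical
  by_contra! hcon
  obtain ⟨⟨i, hi⟩, hcon⟩ := hcon
  have hn : 0 < n := i.pos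
  have hn' : (0 : ℝ) < n := by exact_mod_cast hn
  obtain ⟨l₀, hl₀, hl₀I⟩ := exists_list_of_lt_cov hGI (not_le.2 hi)
  -- The size condition sits inside the existential so that `choose` gives an operation on all
  -- finite sets, with the default `∅` on large ones.
  have hex : ∀ (j : Fin n) (F : Finset G), ∃ E : Finset G, F.card < n →
      ∀ y : G, 1 / (n : ℝ) < μ (y • A j) →
        ∃ e ∈ E, e⁻¹ * y ∉ (F : Set G) * diffSet G I (A j) := by
    intro j F
    by_cases hF : F.card < n
    · obtain ⟨E, hE⟩ := exists_finset_of_forall_ideal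
        (S := {x : G | (μ (x • A j) : ℝ) > 1 / (n : ℝ)}) (B := diffSet G I (A j)) (n := n)
        (fun ⟨J, h1, h2, h3, h4⟩ => (hcon j J h1 h2 h3).not_gt h4) hF
      exact ⟨E, fun _ y hy => hE y hy⟩
    · exact ⟨∅, fun h => absurd h hF⟩
  choose E hE using hex
  obtain ⟨H, ⟨-, hHne⟩, -, hl₀H, hEH⟩ := hμ (closedSubgroups l₀.toFinset E) (fun H hH => hH.1)
    (isClosedFamily_closedSubgroups _ _) (isDominatingFamily_closedSubgroups _ _)
  obtain ⟨ν, hν0, hν1, hνadd, hνI, hrec⟩ := exists_recurrent_null_measure hGI hHne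
  -- some translate of some piece has measure greater than `1 / n`
  obtain ⟨f, hfl, hf⟩ : ∃ f ∈ l₀, ν (f • A i) < 1 / n := by
    by_contra! hlarge
    have h1 := hνadd.sum_le_one hν0 hν1 hνI hl₀I
    have h2 := List.card_nsmul_le_sum ((l₀.map fun f => f • A i).map ν) (1 / n : ℝ)
      (by simpa using hlarge)
    rw [List.length_map, List.length_map, hl₀, nsmul_eq_mul] at h2
    have h3 : ((n + 1 : ℕ) : ℝ) * (1 / n) = 1 + 1 / n := by
      push_cast
      field_simp
    have h4 : 0 < 1 / (n : ℝ) := by positivity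
    linarith
  -- The `n` sets `f • A j` partition `X`; one has mass below the average `1 / n`, so another lies
  -- above it.
  obtain ⟨j, hj⟩ : ∃ j, 1 / n < ν (f • A j) := by
    by_contra! hsmall
    have h1 := hνadd.sum_partition (A := fun j => f • A j) fun j k hjk =>
      (Set.disjoint_image_iff (MulAction.injective f)).2 (hdisj hjk)
    rw [← Set.smul_set_iUnion, hA, Set.smul_set_univ, hν1] at h1
    have h2 : ∑ j, ν (f • A j) < ∑ _j : Fin n, 1 / (n : ℝ) :=
      Finset.sum_lt_sum (fun j _ => hsmall j) ⟨i, Finset.mem_univ _, hf⟩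
    rw [← h1, Finset.sum_const, Finset.card_univ, Fintype.card_fin, nsmul_eq_mul,
      mul_one_div_cancel hn'.ne'] at h2
    exact lt_irrefl _ h2
  -- that piece has `n` translates of such measure that are disjoint modulo `I`
  have hgrow : ∀ k ≤ n, ∃ l : List G, l.length = k ∧ (∀ g ∈ l, g ∈ H ∧ 1 / n < ν (g • A j)) ∧
      (l.map fun g => g • A j).Pairwise fun s t => s ∩ t ∈ I := by
    intro k
    induction k with
    | zero => exact fun _ => ⟨[], by simp⟩
    | succ k ih =>
      intro hk
      obtain ⟨l, hlk, hlH, hlI⟩ := ih (by omega)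
      have hcard : l.toFinset.card < n := l.toFinset_card_le.trans_lt (by omega)
      have hEl := hEH j l.toFinset fun g hg => (hlH g (by simpa using hg)).1
      -- The suitable `e` is known only after `y`, so `ν` has to stay large for every `e⁻¹` at once.
      -- This is where closure of `H` under `E` is used.
      obtain ⟨y, hyH, hyμ, hyν⟩ := hrec (1 / n) (by positivity) _ hj
        ((E j l.toFinset).image (·⁻¹)) (by
          intro z hz
          obtain ⟨e, he, rfl⟩ := Finset.mem_image.1 hz
          exact H.inv_mem (hEl he))
      rw [smul_smul] at hyμ
      obtain ⟨e, he, hye⟩ := hE j l.toFinset hcard (y * f) hyμ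
      refine ⟨(e⁻¹ * (y * f)) :: l, by simp [hlk], ?_, pairwise_cons_of_notMem hGI hlI hye⟩
      intro g hg
      rcases List.mem_cons.1 hg with rfl | hg
      · refine ⟨H.mul_mem (H.inv_mem (hEl he)) (H.mul_mem hyH (hl₀H ?_)), ?_⟩
        · simpa using hfl
        · rw [mul_smul, mul_smul]
          exact hyν _ (Finset.mem_image_of_mem _ he)
      · exact hlH g hg
  obtain ⟨l, hln, hlH, hlI⟩ := hgrow n le_rfl
  have h1 := hνadd.sum_le_one hν0 hν1 hνI hlI
  have h2 : (l.map fun _ => 1 / (n : ℝ)).sum < (l.map fun g => ν (g • A j)).sum :=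
    List.sum_lt_sum_of_ne_nil (by rintro rfl; simp at hln; omega) _ _ fun g hg => (hlH g hg).2
  rw [List.map_const', List.sum_replicate, hln, nsmul_eq_mul, mul_one_div_cancel hn'.ne'] at h2
  rw [List.map_map] at h1
  exact h2.not_ge h1
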